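/- Let $1<\alpha<2$. Then there exist a vector field $u=(u^1,u^2)\in C^2(\mathbb{R}^2\setminus\{0\};\mathbb{R}^2)$ and a function $p\in C^1(\mathbb{R}^2\setminus\{0\})$ with the following properties. (1) $(u,p)$ solves the stationary incompressible Euler equations $u\cdot\nabla u+\nabla p=0$, $\nabla\cdot u=0$ in $\mathbb{R}^2\setminus\{0\}$. (2) $u$ is $(-\alpha)$-homogeneous and $p$ is $(-2\alpha)$-homogeneous, that is, $u(\lambda x)=\lambda^{-\alpha}u(x)$ and $p(\lambda x)=\lambda^{-2\alpha}p(x)$ for all $\lambda>0$ and $x\neq 0$; moreover $|x|^{2\alpha}p(x)$ is constant on $\mathbb{R}^2\setminus\{0\}$. (3) $(u,p)$ is reflection symmetric: $u^1(x_1,-x_2)=u^1(x_1,x_2)$, $u^2(x_1,-x_2)=-u^2(x_1,x_2)$, $p(x_1,-x_2)=p(x_1,x_2)$. (4) $u$ is rotational: the vorticity $\partial_1u^2-\partial_2u^1$ does not vanish identically on $\mathbb{R}^2\setminus\{0\}$. (5) $u$ has a $(1-\alpha)$-homogeneous stream function $\psi:\mathbb{R}^2\setminus\{0\}\to\mathbb{R}$,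 $u=(\partial_2\psi,-\partial_1\psi)$, whose level sets are homeomorphic to those of the stream function $\psi_0(x)=x_2/|x|^2=\sin\phi/r$ of the irrotational $(-2)$-homogeneous (dipole) solution, in the following sense: there is a homeomorphism $h:\mathbb{R}^2\to\mathbb{R}^2$ with $h(0)=0$ such that $$h\bigl(\{x\in\mathbb{R}^2\setminus\{0\}:\psi(x)=k\}\bigr)=\{x\in\mathbb{R}^2\setminus\{0\}:\psi_0(x)=k\}\qquad\text{for every }k\in\mathbb{R}.$$ -/

import Mathlib

/-- The Euclidean plane. The coordinates `(x₁, x₂)` are `(x 0, x 1)`. -/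
abbrev Plane : Type := EuclideanSpace ℝ (Fin 2)

/-- The partial derivative `∂ᵢ f (x)`. -/
noncomputable def partialDeriv (i : Fin 2) (f : Plane → ℝ) (x : Plane) : ℝ :=
  fderiv ℝ f x (EuclideanSpace.single i 1)

/-- `(u, p)` is a classical (`C¹`) solution on `ℝ² ∖ {0}` of the stationary incompressible Euler
equations `u · ∇u + ∇p = 0`, `∇ · u = 0`. -/
structure IsEulerSolution (u : Plane → Plane) (p : Plane → ℝ) : Prop where
  contDiffOn_velocity : ContDiffOn ℝ 1 u {0}ᶜ
  contDiffOn_pressure : ContDiffOn ℝ 1 p {0}ᶜ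
  momentum : ∀ x : Plane, x ≠ 0 → ∀ i : Fin 2,
    ∑ j : Fin 2, u x j * partialDeriv j (fun y => u y i) x + partialDeriv i p x = 0
  divergence_free : ∀ x : Plane, x ≠ 0 →
    ∑ j : Fin 2, partialDeriv j (fun y => u y j) x = 0

/-- `f` is positively homogeneous of degree `d` on `ℝ² ∖ {0}`. -/
def IsHomogeneousOfDegree {F : Type*} [SMul ℝ F] (d : ℝ) (f : Plane → F) : Prop :=
  ∀ c : ℝ, 0 < c → ∀ x : Plane, x ≠ 0 → f (c • x) = c ^ d • f x

/-- The reflection `(x₁, x₂) ↦ (x₁, -x₂)`. -/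
noncomputable def reflectPlane (x : Plane) : Plane := !₂[x 0, -x 1]

/-- Reflection symmetry of `(u, p)`: `u¹` and `p` are even and `u²` is odd in `x₂`. -/
def IsReflectionSymmetric (u : Plane → Plane) (p : Plane → ℝ) : Prop :=
  ∀ x : Plane, x ≠ 0 →
    u (reflectPlane x) 0 = u x 0 ∧ u (reflectPlane x) 1 = -u x 1 ∧ p (reflectPlane x) = p x

/-- The scalar vorticity `ω = ∂₁u² - ∂₂u¹`. -/
noncomputable def vorticity (u : Plane → Plane) (x : Plane) : ℝ :=
  partialDeriv 0 (fun y => u y 1) x - partialDeriv 1 (fun y => u y 0) x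

/-- `u` is rotational: its vorticity does not vanish identically on `ℝ² ∖ {0}`. -/
def IsRotational (u : Plane → Plane) : Prop :=
  ∃ x : Plane, x ≠ 0 ∧ vorticity u x ≠ 0

/-- `ψ` is a stream function of `u` on `ℝ² ∖ {0}`: `u = (∂₂ψ, -∂₁ψ)`. -/
def IsStreamFunction (ψ : Plane → ℝ) (u : Plane → Plane) : Prop :=
  ∀ x : Plane, x ≠ 0 →
    DifferentiableAt ℝ ψ x ∧ u x 0 = partialDeriv 1 ψ x ∧ u x 1 = -partialDeriv 0 ψ x

/-- The stream function `sin φ / r = x₂ / |x|²` of the irrotational `(-2)`-homogeneous reflection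
symmetric solution (the dipole). -/
noncomputable def dipoleStream (x : Plane) : ℝ := x 1 / ‖x‖ ^ 2

/-- The level set `{x ∈ ℝ² ∖ {0} | ψ x = k}`. -/
def levelSet (ψ : Plane → ℝ) (k : ℝ) : Set Plane := {x | x ≠ 0 ∧ ψ x = k}

/-- The level sets of `ψ₁` are homeomorphic to those of `ψ₂`, also as subsets of the plane and
together with the origin, which is a limit point of level sets: one homeomorphism of the plane that
fixes the origin carries every level set of `ψ₁` onto the level set of `ψ₂` of the same value.
In particular the subspaces `levelSet ψ₁ k` and `levelSet ψ₂ k` are homeomorphic, and so are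
the curves `levelSet ψ₁ k ∪ {0}` and `levelSet ψ₂ k ∪ {0}`. -/
def HaveHomeomorphicLevelSets (ψ₁ ψ₂ : Plane → ℝ) : Prop :=
  ∃ h : Plane ≃ₜ Plane, h 0 = 0 ∧ ∀ k : ℝ, h '' levelSet ψ₁ k = levelSet ψ₂ k

/-! Put `α = b + 1` with `0 < b < 1` and look for `ψ = r ^ (-b) w(φ)`, `p = -(κ / 2) r ^ (-2(b +
1))`. The angular momentum equation then holds identically, and the radial one is `b w w'' = (b + 1)
w'² + b² w² - (b + 1) κ`. With `m = 1 + 1 / b`, solutions of amplitude one come from the first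
integral `w'² = b² (1 - w²) + C (1 - |w|^{2m})`, where `κ = b² + C`.

The substitution `w = sin Θ` removes the degeneracy at the turning points: `Θ'² = b² + C (1 - |sin
Θ|^{2m}) / cos² Θ`, whose quotient extends continuously and is at least one. The phase therefore
never stops, and it only remains to choose `C` so that it advances by `π` as `φ` does, i.e. `∫₀^π dθ
/ Θ' = π`. This integral is `π / b > π` at `C = 0` and at most `π` at `C = 1 - b²`, so some `C > 0`
works (`exists_half_period`).

The phase is then an odd homeomorphism of the line commuting with the shift by `π` (`exists_phase`).
Since `w'' + b² w = -C m |w|^{2/b} w` with `C > 0`, the flow is rotational, and `2 / b > 2` yields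
the regularity (`exists_profile`). The map `r e^{iφ} ↦ r ^ b e^{iΘ(φ)}` turns `r ^ (-b) sin Θ` into
the dipole `sin φ / r`. -/

/-! ### The chord slope of the power function -/

/-- The chord slope `(1 - t ^ m) / (1 - t)` at `t = sin² θ`, extended continuously by `m` to the
zeros of `cos`. -/
noncomputable def sineChord (m θ : ℝ) : ℝ := dslope (fun t : ℝ => t ^ m) 1 (Real.sin θ ^ 2)

theorem continuous_sineChord {m : ℝ} (hm : 1 ≤ m) : Continuous (sineChord m) := by
  have hd : Differentiable ℝ (fun t : ℝ => t ^ m) := fun t =>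
    (Real.hasDerivAt_rpow_const (Or.inr hm)).differentiableAt
  have h : Continuous (dslope (fun t : ℝ => t ^ m) 1) := by
    rw [← continuousOn_univ, continuousOn_dslope Filter.univ_mem]
    exact ⟨hd.continuous.continuousOn, hd 1⟩
  exact h.comp (by fun_prop)

theorem cos_sq_mul_sineChord (m θ : ℝ) :
    Real.cos θ ^ 2 * sineChord m θ = 1 - (Real.sin θ ^ 2) ^ m := by
  have h := sub_smul_dslope (fun t : ℝ => t ^ m) 1 (Real.sin θ ^ 2)
  simp only [smul_eq_mul, Real.one_rpow] at h
  rw [Real.cos_sq', sineChord]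
  linarith

/-- For `t ∈ [0, 1]` and `m ≥ 1`, `t ^ m ≤ t`, so `1 - t ^ m ≥ 1 - t`; at `t = 1` the slope is `m`.
This is the lower bound on the phase speed used to locate `C`. -/
theorem one_le_sineChord {m : ℝ} (hm : 1 ≤ m) (θ : ℝ) : 1 ≤ sineChord m θ := by
  by_cases hc : Real.cos θ = 0
  · have hs : Real.sin θ ^ 2 = 1 := by
      have := Real.sin_sq_add_cos_sq θ
      rw [hc] at this
      linarith
    rw [sineChord, hs, dslope_same, (Real.hasDerivAt_rpow_const (Or.inr hm)).deriv]
    simpa using hm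
  · have hc2 : 0 < Real.cos θ ^ 2 := by positivity
    have h1 : (Real.sin θ ^ 2) ^ m ≤ Real.sin θ ^ 2 := by
      have := Real.rpow_le_rpow_of_exponent_ge_of_imp (sq_nonneg (Real.sin θ))
        (Real.sin_sq_le_one θ) hm (by rintro - h; linarith)
      simpa using this
    have h2 := cos_sq_mul_sineChord m θ
    have h3 := Real.sin_sq_add_cos_sq θ
    nlinarith

theorem sineChord_neg (m θ : ℝ) : sineChord m (-θ) = sineChord m θ := by
  simp [sineChord]

theorem sineChord_add_pi (m θ : ℝ) : sineChord m (θ + Real.pi) = sineChord m θ := by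
  simp [sineChord]

theorem hasDerivAt_sineChord {m θ : ℝ} (hm : 1 ≤ m) (hc : Real.cos θ ≠ 0) :
    HasDerivAt (sineChord m)
      ((-(2 * Real.sin θ * Real.cos θ * m * (Real.sin θ ^ 2) ^ (m - 1)) * Real.cos θ ^ 2
        + (1 - (Real.sin θ ^ 2) ^ m) * (2 * Real.cos θ * Real.sin θ)) /
        (Real.cos θ ^ 2) ^ 2) θ := by
  have h1 : HasDerivAt (fun θ : ℝ => Real.sin θ ^ 2) (2 * Real.sin θ * Real.cos θ) θ := by
    simpa using (Real.hasDerivAt_sin θ).fun_pow 2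
  have h2 : HasDerivAt (fun θ : ℝ => Real.cos θ ^ 2) (-(2 * Real.cos θ * Real.sin θ)) θ := by
    simpa using (Real.hasDerivAt_cos θ).fun_pow 2
  have h3 := ((h1.rpow_const (p := m) (Or.inr hm)).const_sub 1).div h2 (pow_ne_zero 2 hc)
  have h4 : sineChord m =ᶠ[nhds θ]
      (fun θ => (1 - (Real.sin θ ^ 2) ^ m) / Real.cos θ ^ 2) := by
    filter_upwards [Real.continuous_cos.continuousAt.eventually_ne hc] with t ht
    rw [eq_div_iff (pow_ne_zero 2 ht), ← cos_sq_mul_sineChord]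
    ring
  refine (h3.congr_of_eventuallyEq h4).congr_deriv ?_
  congr 1
  ring

theorem countable_cos_eq_zero : {θ : ℝ | Real.cos θ = 0}.Countable := by
  refine (Set.countable_range (fun k : ℤ => (2 * (k : ℝ) + 1) * Real.pi / 2)).mono ?_
  intro θ hθ
  obtain ⟨k, hk⟩ := Real.cos_eq_zero_iff.1 hθ
  exact ⟨k, hk.symm⟩

/-- A continuous function which has, off a countable set, the values of a continuous function as
derivatives, has them everywhere. -/
theorem hasDerivAt_of_off_countable {f g : ℝ → ℝ} {s : Set ℝ} (hs : s.Countable)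
    (hf : Continuous f) (hg : Continuous g) (h : ∀ x, x ∉ s → HasDerivAt f (g x) x) (x : ℝ) :
    HasDerivAt f (g x) x := by
  -- The fundamental theorem of calculus tolerates a countable exceptional set; the resulting
  -- primitive of a continuous function is differentiable everywhere.
  have h1 : f = fun y => f 0 + ∫ t in (0 : ℝ)..y, g t := by
    funext y
    rw [MeasureTheory.integral_eq_of_hasDerivAt_off_countable f g hs hf.continuousOn
      (fun x hx => h x hx.2) (hg.intervalIntegrable _ _)]
    ring
  rw [h1]
  exact (intervalIntegral.integral_hasDerivAt_right (hg.intervalIntegrable _ _)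
    (hg.stronglyMeasurableAtFilter _ _) hg.continuousAt).const_add _

/-! ### The phase speed -/

/-- The speed `θ' = √(b² + C (1 - |sin θ|^{2m}) / cos² θ)` of the phase. -/
noncomputable def phaseSpeed (b C m θ : ℝ) : ℝ := √(b ^ 2 + C * sineChord m θ)

section Speed
variable {b C m : ℝ}

theorem speed_radicand_pos (hb : 0 < b) (hC : 0 ≤ C) (hm : 1 ≤ m) (θ : ℝ) :
    0 < b ^ 2 + C * sineChord m θ := by
  have := one_le_sineChord hm θ
  positivity

theorem phaseSpeed_pos (hb : 0 < b) (hC : 0 ≤ C) (hm : 1 ≤ m) (θ : ℝ) :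
    0 < phaseSpeed b C m θ :=
  Real.sqrt_pos.2 (speed_radicand_pos hb hC hm θ)

theorem sq_phaseSpeed (hb : 0 < b) (hC : 0 ≤ C) (hm : 1 ≤ m) (θ : ℝ) :
    phaseSpeed b C m θ ^ 2 = b ^ 2 + C * sineChord m θ :=
  Real.sq_sqrt (speed_radicand_pos hb hC hm θ).le

theorem continuous_phaseSpeed (hm : 1 ≤ m) : Continuous (phaseSpeed b C m) := by
  have := continuous_sineChord hm
  unfold phaseSpeed
  fun_prop

/-- Where `cos θ ≠ 0`, differentiate `(cos θ · S)² = b² cos² θ + C (1 - |sin θ|^{2m})` and cancel `2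
cos θ`. The result is continuous across the zeros of `cos`, so it persists there although the
quotient formula for the chord slope does not. -/
theorem hasDerivAt_cos_mul_phaseSpeed (hb : 0 < b) (hC : 0 ≤ C) (hm : 1 ≤ m) (θ : ℝ) :
    HasDerivAt (fun θ => Real.cos θ * phaseSpeed b C m θ)
      ((-(b ^ 2 * Real.sin θ) - C * m * (Real.sin θ ^ 2) ^ (m - 1) * Real.sin θ) /
        phaseSpeed b C m θ) θ := by
  have hS : Continuous (phaseSpeed b C m) := continuous_phaseSpeed hm
  have hpow : Continuous fun θ : ℝ => (Real.sin θ ^ 2) ^ (m - 1) :=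
    (Real.continuous_rpow_const (by linarith)).comp (by fun_prop)
  refine hasDerivAt_of_off_countable (g := fun θ =>
    (-(b ^ 2 * Real.sin θ) - C * m * (Real.sin θ ^ 2) ^ (m - 1) * Real.sin θ) /
        phaseSpeed b C m θ) countable_cos_eq_zero (by fun_prop) ?_ ?_ θ
  · exact Continuous.div (by fun_prop) hS fun θ => (phaseSpeed_pos hb hC hm θ).ne'
  · intro θ hc
    have hc : Real.cos θ ≠ 0 := hc
    have hpos := phaseSpeed_pos hb hC hm θ
    have hd := (Real.hasDerivAt_cos θ).mul
      ((((hasDerivAt_sineChord hm hc).const_mul C).const_add (b ^ 2)).sqrt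
        (speed_radicand_pos hb hC hm θ).ne')
    refine hd.congr_deriv ?_
    have hsq := sq_phaseSpeed hb hC hm θ
    change -Real.sin θ * phaseSpeed b C m θ + Real.cos θ * (_ / (2 * phaseSpeed b C m θ)) = _
    have hN := cos_sq_mul_sineChord m θ
    set S := phaseSpeed b C m θ
    rw [← hN, eq_div_iff hpos.ne']
    field_simp
    rw [hsq]
    ring

end Speed

/-! ### Adjusting the period and inverting the phase -/

section Period
variable {b m : ℝ}

/-- Intermediate value theorem in `C` on `[0, 1 - b²]`; the strict inequality `π < π / b` excludes
`C = 0`, which would make the flow irrotational. -/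
theorem exists_half_period (hb : 0 < b) (hb1 : b < 1) (hm : 1 ≤ m) :
    ∃ C : ℝ, 0 < C ∧ ∫ θ in (0 : ℝ)..Real.pi, (phaseSpeed b C m θ)⁻¹ = Real.pi := by
  have hK := continuous_sineChord hm
  -- `max C 0` makes the integrand continuous for all parameters
  let F : ℝ → ℝ := fun C => ∫ θ in (0 : ℝ)..Real.pi, (phaseSpeed b (max C 0) m θ)⁻¹
  have hF : Continuous F := by
    refine intervalIntegral.continuous_parametric_intervalIntegral_of_continuous' ?_ _ _
    refine Continuous.inv₀ ?_ fun q => (phaseSpeed_pos hb (le_max_right _ _) hm q.2).ne'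
    unfold phaseSpeed
    fun_prop
  have hb2 : 0 ≤ 1 - b ^ 2 := by nlinarith
  have h0 : F 0 = Real.pi / b := by
    simp [F, phaseSpeed, Real.sqrt_sq hb.le, div_eq_mul_inv]
  have hlt : Real.pi < Real.pi / b := by
    rw [lt_div_iff₀ hb]
    nlinarith [Real.pi_pos]
  -- As the chord slope is at least one, this `C` makes the radicand at least `b² + (1 - b²) = 1`.
  have h1 : F (1 - b ^ 2) ≤ Real.pi := by
    have hle : F (1 - b ^ 2) ≤ ∫ θ in (0 : ℝ)..Real.pi, (1 : ℝ) := by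
      refine intervalIntegral.integral_mono_on Real.pi_pos.le ?_ (by simp) ?_
      · exact (Continuous.inv₀ (continuous_phaseSpeed hm) fun θ =>
          (phaseSpeed_pos hb (le_max_right _ _) hm θ).ne').intervalIntegrable _ _
      · intro θ _
        refine inv_le_one_of_one_le₀ (Real.one_le_sqrt.2 ?_)
        rw [max_eq_left hb2]
        nlinarith [one_le_sineChord hm θ]
    simpa using hle
  obtain ⟨C, hC, hFC⟩ := intermediate_value_Icc' hb2 hF.continuousOn
    ⟨h1, h0 ▸ hlt.le⟩
  refine ⟨C, lt_of_le_of_ne hC.1 ?_, ?_⟩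
  · rintro rfl
    rw [h0] at hFC
    exact hlt.ne' hFC
  · simpa [F, max_eq_left hC.1] using hFC

/-- A homeomorphism of the line inverting the primitive of a positive, even, `π`-periodic function
of mean one. -/
theorem exists_phase {S : ℝ → ℝ} (hS : Continuous S) (hpos : ∀ θ, 0 < S θ)
    (heven : ∀ θ, S (-θ) = S θ) (hper : ∀ θ, S (θ + Real.pi) = S θ)
    (hint : ∫ θ in (0 : ℝ)..Real.pi, (S θ)⁻¹ = Real.pi) :
    ∃ Θ : ℝ ≃ₜ ℝ, StrictMono Θ ∧ (∀ φ, Θ (-φ) = -Θ φ) ∧ (∀ φ, Θ (φ + Real.pi) = Θ φ + Real.pi) ∧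
      ∀ φ, HasDerivAt Θ (S (Θ φ)) φ := by
  have hG : Continuous fun θ => (S θ)⁻¹ := hS.inv₀ fun θ => (hpos θ).ne'
  have hGi : ∀ a b, IntervalIntegrable (fun θ => (S θ)⁻¹) MeasureTheory.volume a b :=
    hG.intervalIntegrable
  have hGper : Function.Periodic (fun θ => (S θ)⁻¹) Real.pi := fun θ => by simp [hper]
  let Φ : ℝ → ℝ := fun θ => ∫ t in (0 : ℝ)..θ, (S t)⁻¹
  have hd : ∀ θ, HasDerivAt Φ (S θ)⁻¹ θ := fun θ =>
    intervalIntegral.integral_hasDerivAt_right (hGi _ _)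
      (hG.stronglyMeasurableAtFilter _ _) hG.continuousAt
  have hcont : Continuous Φ := continuous_iff_continuousAt.2 fun θ => (hd θ).continuousAt
  have hmono : StrictMono Φ := strictMono_of_hasDerivAt_pos hd fun θ => inv_pos.2 (hpos θ)
  have hsurj : Function.Surjective Φ := by
    refine hcont.surjective ?_ ?_
    · exact hGper.tendsto_atTop_intervalIntegral_of_pos' (hGi _ _)
        (fun θ => inv_pos.2 (hpos θ)) Real.pi_pos
    · exact hGper.tendsto_atBot_intervalIntegral_of_pos' (hGi _ _)
        (fun θ => inv_pos.2 (hpos θ)) Real.pi_pos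
  have hodd : ∀ θ, Φ (-θ) = -Φ θ := fun θ => by
    have := intervalIntegral.integral_comp_neg (a := 0) (b := θ) (fun t => (S t)⁻¹)
    simp only [heven, neg_zero] at this
    simp only [Φ]
    rw [this, intervalIntegral.integral_symm]
  have hadd : ∀ θ, Φ (θ + Real.pi) = Φ θ + Real.pi := fun θ => by
    have h1 := hGper.intervalIntegral_add_eq θ 0
    rw [zero_add, hint] at h1
    have h2 := intervalIntegral.integral_add_adjacent_intervals (hGi 0 θ) (hGi θ (θ + Real.pi))
    simp only [Φ]
    rw [← h2, h1]
  let e := (hmono.orderIsoOfSurjective Φ hsurj).toHomeomorph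
  have he : ∀ θ, e θ = Φ θ := fun θ => rfl
  have hinv : ∀ φ, Φ (e.symm φ) = φ := fun φ => e.apply_symm_apply φ
  refine ⟨e.symm, ?_, ?_, ?_, ?_⟩
  · exact (hmono.orderIsoOfSurjective Φ hsurj).symm.strictMono
  · intro φ
    apply hmono.injective
    rw [hodd, hinv, hinv]
  · intro φ
    apply hmono.injective
    rw [hadd, hinv, hinv]
  · intro φ
    -- The inverse function rule gives `Θ' = 1 / Φ'(Θ) = S(Θ)`; continuity of `S` suffices, with no
    -- Lipschitz condition.
    have := HasDerivAt.of_local_left_inverse (f := Φ) (g := e.symm) (a := φ)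
      e.symm.continuous.continuousAt (hd (e.symm φ)) (inv_pos.2 (hpos _)).ne'
      (Filter.Eventually.of_forall hinv)
    simpa using this

end Period

/-! ### The angular profile -/

/-- The angular profile `w = sin ∘ Θ` of the stream function, with its first two derivatives `v`
and `a`. -/
theorem exists_profile {b : ℝ} (hb : 0 < b) (hb1 : b < 1) :
    ∃ (Θ : ℝ ≃ₜ ℝ) (v a : ℝ → ℝ) (κ : ℝ),
      (∀ φ, Θ (-φ) = -Θ φ) ∧ (∀ φ, Θ (φ + Real.pi) = Θ φ + Real.pi) ∧
      (∀ φ, HasDerivAt (fun φ => Real.sin (Θ φ)) (v φ) φ) ∧ (∀ φ, HasDerivAt v (a φ) φ) ∧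
      ContDiff ℝ 1 a ∧
      (∀ φ, b * Real.sin (Θ φ) * a φ =
        (b + 1) * v φ ^ 2 + b ^ 2 * Real.sin (Θ φ) ^ 2 - (b + 1) * κ) ∧
      a (Real.pi / 2) + b ^ 2 * Real.sin (Θ (Real.pi / 2)) ≠ 0 := by
  -- The exponent is forced by `b m = b + 1`, which cancels the `|w|^{2m}` terms in the differential
  -- equation.
  set m : ℝ := 1 + b⁻¹ with hmdef
  have hbi : 1 < b⁻¹ := (one_lt_inv₀ hb).2 hb1
  have hm : 1 ≤ m := by linarith
  have hbm : b * m = b + 1 := by rw [hmdef]; field_simp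
  obtain ⟨C, hC, hint⟩ := exists_half_period hb hb1 hm
  obtain ⟨Θ, hmono, hodd, hadd, hder⟩ := exists_phase (continuous_phaseSpeed hm)
    (phaseSpeed_pos hb hC.le hm) (fun θ => by simp [phaseSpeed, sineChord_neg])
    (fun θ => by simp [phaseSpeed, sineChord_add_pi]) hint
  have hw : ∀ φ, HasDerivAt (fun φ => Real.sin (Θ φ))
      (Real.cos (Θ φ) * phaseSpeed b C m (Θ φ)) φ := fun φ => (hder φ).sin
  have hΘ : ContDiff ℝ 1 fun φ => Real.sin (Θ φ) := by
    refine contDiff_one_iff_deriv.2 ⟨fun φ => (hw φ).differentiableAt, ?_⟩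
    rw [show deriv (fun φ => Real.sin (Θ φ)) = _ from funext fun φ => (hw φ).deriv]
    have := continuous_phaseSpeed (b := b) (C := C) hm
    fun_prop
  refine ⟨Θ, fun φ => Real.cos (Θ φ) * phaseSpeed b C m (Θ φ),
    fun φ => -(b ^ 2 * Real.sin (Θ φ)) -
      C * m * (Real.sin (Θ φ) ^ 2) ^ (m - 1) * Real.sin (Θ φ), b ^ 2 + C, hodd, hadd, hw,
      ?_, ?_, ?_, ?_⟩
  · intro φ
    have h := (hasDerivAt_cos_mul_phaseSpeed hb hC.le hm (Θ φ)).comp φ (hder φ)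
    refine h.congr_deriv ?_
    have := (phaseSpeed_pos hb hC.le hm (Θ φ)).ne'
    field_simp
  -- Here `m - 1 = 1 / b > 1`, so the power is `C¹` even where `sin Θ` vanishes.
  · have h1 : ContDiff ℝ 1 fun φ => (Real.sin (Θ φ) ^ 2) ^ (m - 1) :=
      (Real.contDiff_rpow_const_of_le (n := 1) (by push_cast; linarith)).comp (hΘ.pow 2)
    fun_prop
  · intro φ
    have hp : (Real.sin (Θ φ) ^ 2) ^ m =
        (Real.sin (Θ φ) ^ 2) ^ (m - 1) * Real.sin (Θ φ) ^ 2 := by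
      rw [← Real.rpow_add_one' (sq_nonneg _) (by linarith)]
      congr 1
      ring
    have h1 := cos_sq_mul_sineChord m (Θ φ)
    have hv : (Real.cos (Θ φ) * phaseSpeed b C m (Θ φ)) ^ 2 = b ^ 2 * (1 - Real.sin (Θ φ) ^ 2) +
        C * (1 - (Real.sin (Θ φ) ^ 2) ^ (m - 1) * Real.sin (Θ φ) ^ 2) := by
      rw [← hp, ← h1, ← Real.cos_sq', mul_pow, sq_phaseSpeed hb hC.le hm]
      ring
    beta_reduce
    rw [hv]
    linear_combination (-(C * (Real.sin (Θ φ) ^ 2) ^ (m - 1) * Real.sin (Θ φ) ^ 2)) * hbm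
  -- The quantity is `-C m |w|^{2/b} w` at `π / 2`, nonzero because `0 < Θ (π / 2) < π` by
  -- monotonicity.
  · have hz : Θ 0 = 0 := by
      have := hodd 0
      rw [neg_zero] at this
      linarith
    have hpi : Θ Real.pi = Real.pi := by simpa [hz] using hadd 0
    have h1 : 0 < Θ (Real.pi / 2) := hz ▸ hmono (by positivity : (0 : ℝ) < Real.pi / 2)
    have h2 : Θ (Real.pi / 2) < Real.pi := by
      have := hmono (by linarith [Real.pi_pos] : Real.pi / 2 < Real.pi)
      rwa [hpi] at this
    have hs := Real.sin_pos_of_pos_of_lt_pi h1 h2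
    have hm0 : 0 < m := by linarith
    have : 0 < C * m * (Real.sin (Θ (Real.pi / 2)) ^ 2) ^ (m - 1) * Real.sin (Θ (Real.pi / 2)) := by
      positivity
    beta_reduce
    intro h
    linarith

/-! ### Calculus in polar coordinates -/

/-- The identification of the plane with `ℂ`. -/
noncomputable def planeToComplex : Plane ≃ₗᵢ[ℝ] ℂ := Complex.orthonormalBasisOneI.repr.symm

theorem planeToComplex_apply (x : Plane) : planeToComplex x = x 0 + x 1 * Complex.I :=
  Complex.orthonormalBasisOneI_repr_symm_apply x

theorem planeToComplex_re (x : Plane) : (planeToComplex x).re = x 0 := by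
  simp [planeToComplex_apply]

theorem planeToComplex_im (x : Plane) : (planeToComplex x).im = x 1 := by
  simp [planeToComplex_apply]

theorem planeToComplex_ne_zero {x : Plane} (hx : x ≠ 0) : planeToComplex x ≠ 0 := by simpa

/-- The polar angle of a point of the plane, in `(-π, π]`. -/
noncomputable def polarAngle (x : Plane) : ℝ := (planeToComplex x).arg

theorem norm_mul_cos_polarAngle (x : Plane) : ‖x‖ * Real.cos (polarAngle x) = x 0 := by
  rw [← planeToComplex_re, ← planeToComplex.norm_map]
  exact Complex.norm_mul_cos_arg _

theorem norm_mul_sin_polarAngle (x : Plane) : ‖x‖ * Real.sin (polarAngle x) = x 1 := by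
  rw [← planeToComplex_im, ← planeToComplex.norm_map]
  exact Complex.norm_mul_sin_arg _

theorem polarAngle_smul {c : ℝ} (hc : 0 < c) (x : Plane) :
    polarAngle (c • x) = polarAngle x := by
  rw [polarAngle, map_smul, Complex.real_smul, Complex.arg_real_mul _ hc, polarAngle]

/-- The function `r ^ γ f(φ)` of the polar coordinates. -/
noncomputable def polarFun (γ : ℝ) (f : ℝ → ℝ) (x : Plane) : ℝ := ‖x‖ ^ γ * f (polarAngle x)

theorem polarFun_smul (γ : ℝ) (f : ℝ → ℝ) {c : ℝ} (hc : 0 < c) (x : Plane) :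
    polarFun γ f (c • x) = c ^ γ * polarFun γ f x := by
  rw [polarFun, polarAngle_smul hc, norm_smul, Real.norm_of_nonneg hc.le,
    Real.mul_rpow hc.le (norm_nonneg x), mul_assoc, polarFun]

theorem Function.Periodic.eq_of_angle_eq {X : Type*} {f : ℝ → X}
    (hf : Function.Periodic f (2 * Real.pi)) {s t : ℝ} (h : (s : Real.Angle) = t) : f s = f t := by
  obtain ⟨k, hk⟩ := Real.Angle.angle_eq_iff_two_pi_dvd_sub.1 h
  rw [show s = t + k * (2 * Real.pi) by linarith]
  exact hf.int_mul k t

theorem norm_reflectPlane (x : Plane) : ‖reflectPlane x‖ = ‖x‖ := by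
  simp [EuclideanSpace.norm_eq, reflectPlane]

theorem planeToComplex_reflectPlane (x : Plane) :
    planeToComplex (reflectPlane x) = (starRingEnd ℂ) (planeToComplex x) := by
  simp [planeToComplex_apply, reflectPlane]

/-- Conjugation negates the argument only modulo `2π` (it fixes `π`), hence the periodicity. -/
theorem polarFun_reflectPlane (γ : ℝ) {f : ℝ → ℝ} (hf : Function.Periodic f (2 * Real.pi))
    (x : Plane) : polarFun γ f (reflectPlane x) = polarFun γ (fun φ => f (-φ)) x := by
  rw [polarFun, norm_reflectPlane, polarFun, polarAngle, planeToComplex_reflectPlane]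
  congr 1
  exact hf.eq_of_angle_eq (by rw [Complex.arg_conj_coe_angle, Real.Angle.coe_neg, polarAngle])

/-- The complex logarithm `log (y / x)`, a chart for polar coordinates near `x`. -/
noncomputable def polarChart (x y : Plane) : ℂ :=
  Complex.log ((planeToComplex x)⁻¹ * planeToComplex y)

section Chart
variable {x : Plane}

theorem contDiffAt_polarChart (hx : x ≠ 0) {n : WithTop ℕ∞} : ContDiffAt ℝ n (polarChart x) x := by
  have h1 : (planeToComplex x)⁻¹ * planeToComplex x ∈ Complex.slitPlane := by
    rw [inv_mul_cancel₀ (planeToComplex_ne_zero hx)]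
    exact Complex.one_mem_slitPlane
  have h2 : ContDiffAt ℝ n (fun y => (planeToComplex x)⁻¹ * planeToComplex y) x :=
    contDiffAt_const.mul planeToComplex.contDiff.contDiffAt
  exact ((Complex.contDiffAt_log h1).restrict_scalars ℝ).comp x h2

theorem hasFDerivAt_polarChart (hx : x ≠ 0) :
    HasFDerivAt (polarChart x) ((planeToComplex x)⁻¹ •
      (planeToComplex.toContinuousLinearEquiv : Plane →L[ℝ] ℂ)) x := by
  have h0 := inv_mul_cancel₀ (planeToComplex_ne_zero hx)
  have h1 : HasStrictFDerivAt Complex.log _ ((planeToComplex x)⁻¹ * planeToComplex x) :=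
    Complex.hasStrictFDerivAt_log_real (by rw [h0]; exact Complex.one_mem_slitPlane)
  have h2 : HasFDerivAt (fun y => (planeToComplex x)⁻¹ * planeToComplex y)
      ((planeToComplex x)⁻¹ • (planeToComplex.toContinuousLinearEquiv : Plane →L[ℝ] ℂ)) x :=
    (planeToComplex.toContinuousLinearEquiv.hasFDerivAt).const_mul _
  refine (h1.hasFDerivAt.comp x h2).congr_fderiv ?_
  ext v
  simp [h0]

/-- The principal argument jumps on the negative axis, but `log (y / x)` is smooth near `y = x`, and
a periodic `f` sees angles only modulo `2π`. -/
theorem polarFun_eventuallyEq (hx : x ≠ 0) (γ : ℝ) {f : ℝ → ℝ}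
    (hf : Function.Periodic f (2 * Real.pi)) :
    polarFun γ f =ᶠ[nhds x] fun y => ‖x‖ ^ γ * (Real.exp (γ * (polarChart x y).re) *
      f ((polarChart x y).im + polarAngle x)) := by
  have hzx := planeToComplex_ne_zero hx
  filter_upwards [isOpen_ne.mem_nhds hx] with y hy
  have hzy := planeToComplex_ne_zero hy
  have hq : (planeToComplex x)⁻¹ * planeToComplex y ≠ 0 := mul_ne_zero (inv_ne_zero hzx) hzy
  have hnx := norm_pos_iff.2 hx
  have hny := norm_pos_iff.2 hy
  have h1 : Real.exp (γ * (polarChart x y).re) = (‖x‖⁻¹ * ‖y‖) ^ γ := by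
    rw [polarChart, Complex.log_re, norm_mul, norm_inv, LinearIsometryEquiv.norm_map,
      LinearIsometryEquiv.norm_map, Real.rpow_def_of_pos (by positivity), mul_comm]
  have h2 : f ((polarChart x y).im + polarAngle x) = f (polarAngle y) := by
    refine hf.eq_of_angle_eq ?_
    rw [polarChart, Complex.log_im, Real.Angle.coe_add, polarAngle,
      ← Complex.arg_mul_coe_angle hq hzx, mul_comm, mul_inv_cancel_left₀ hzx, polarAngle]
  rw [h1, h2, Real.mul_rpow (by positivity) hny.le, Real.inv_rpow hnx.le, ← mul_assoc,
    mul_inv_cancel_left₀ (by positivity), polarFun]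

theorem contDiffAt_polarFun (hx : x ≠ 0) (γ : ℝ) {f : ℝ → ℝ}
    (hf : Function.Periodic f (2 * Real.pi)) {n : WithTop ℕ∞} (hn : ContDiff ℝ n f) :
    ContDiffAt ℝ n (polarFun γ f) x := by
  refine ContDiffAt.congr_of_eventuallyEq ?_ (polarFun_eventuallyEq hx γ hf)
  have h := contDiffAt_polarChart hx (n := n)
  have h1 : ContDiffAt ℝ n (fun y => (polarChart x y).re) x :=
    Complex.reCLM.contDiff.contDiffAt.comp x h
  have h2 : ContDiffAt ℝ n (fun y => (polarChart x y).im) x :=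
    Complex.imCLM.contDiff.contDiffAt.comp x h
  exact contDiffAt_const.mul ((contDiffAt_const.mul h1).exp.mul
    (hn.contDiffAt.comp x (h2.add contDiffAt_const)))

/-- The chart has differential `v ↦ v / x` at `x`, with real part `dr / r` and imaginary part `dφ`.
-/
theorem hasFDerivAt_polarFun (hx : x ≠ 0) (γ : ℝ) {f : ℝ → ℝ}
    (hf : Function.Periodic f (2 * Real.pi)) {f' : ℝ} (h : HasDerivAt f f' (polarAngle x)) :
    ∃ L : Plane →L[ℝ] ℝ, HasFDerivAt (polarFun γ f) L x ∧ ∀ v, L v = ‖x‖ ^ γ *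
      (γ * ((planeToComplex x)⁻¹ * planeToComplex v).re * f (polarAngle x) +
        f' * ((planeToComplex x)⁻¹ * planeToComplex v).im) := by
  have hc := hasFDerivAt_polarChart hx
  have h1 := Complex.reCLM.hasFDerivAt.comp x hc
  have h2 := Complex.imCLM.hasFDerivAt.comp x hc
  have h0 : polarChart x x = 0 := by
    rw [polarChart, inv_mul_cancel₀ (planeToComplex_ne_zero hx), Complex.log_one]
  have h' : HasDerivAt f f' ((Complex.imCLM ∘ polarChart x) x + polarAngle x) := by
    simpa [h0] using h
  have h3 := ((h1.const_mul γ).exp.mul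
    (h'.comp_hasFDerivAt x (h2.add_const (polarAngle x)))).const_mul (‖x‖ ^ γ)
  refine ⟨_, h3.congr_of_eventuallyEq (polarFun_eventuallyEq hx γ hf), fun v => ?_⟩
  simp [h0]
  ring

theorem partialDeriv_zero_polarFun (hx : x ≠ 0) (γ : ℝ) {f : ℝ → ℝ}
    (hf : Function.Periodic f (2 * Real.pi)) {f' : ℝ} (h : HasDerivAt f f' (polarAngle x)) :
    partialDeriv 0 (polarFun γ f) x = ‖x‖ ^ (γ - 1) *
      (γ * Real.cos (polarAngle x) * f (polarAngle x) - Real.sin (polarAngle x) * f') := by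
  obtain ⟨L, hL, hv⟩ := hasFDerivAt_polarFun hx γ hf h
  have hn := norm_pos_iff.2 hx
  rw [partialDeriv, hL.fderiv, hv, Real.rpow_sub_one hn.ne']
  have e : planeToComplex (EuclideanSpace.single 0 1) = 1 := by simp [planeToComplex_apply]
  rw [e, mul_one, Complex.inv_re, Complex.inv_im, planeToComplex_re, planeToComplex_im,
    Complex.normSq_eq_norm_sq, LinearIsometryEquiv.norm_map, ← norm_mul_cos_polarAngle,
    ← norm_mul_sin_polarAngle]
  field_simp
  ring

theorem partialDeriv_one_polarFun (hx : x ≠ 0) (γ : ℝ) {f : ℝ → ℝ}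
    (hf : Function.Periodic f (2 * Real.pi)) {f' : ℝ} (h : HasDerivAt f f' (polarAngle x)) :
    partialDeriv 1 (polarFun γ f) x = ‖x‖ ^ (γ - 1) *
      (γ * Real.sin (polarAngle x) * f (polarAngle x) + Real.cos (polarAngle x) * f') := by
  obtain ⟨L, hL, hv⟩ := hasFDerivAt_polarFun hx γ hf h
  have hn := norm_pos_iff.2 hx
  rw [partialDeriv, hL.fderiv, hv, Real.rpow_sub_one hn.ne']
  have e : planeToComplex (EuclideanSpace.single 1 1) = Complex.I := by
    simp [planeToComplex_apply]
  rw [e, Complex.mul_I_re, Complex.mul_I_im, Complex.inv_re, Complex.inv_im, planeToComplex_re,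
    planeToComplex_im, Complex.normSq_eq_norm_sq, LinearIsometryEquiv.norm_map,
    ← norm_mul_cos_polarAngle, ← norm_mul_sin_polarAngle]
  field_simp

end Chart

/-! ### Polar homeomorphisms and level sets -/

/-- The map `r e^{iφ} ↦ r ^ γ e^{iτ(φ)}` of the plane. -/
noncomputable def polarMap (γ : ℝ) (τ : ℝ → ℝ) (x : Plane) : Plane :=
  !₂[polarFun γ (fun φ => Real.cos (τ φ)) x, polarFun γ (fun φ => Real.sin (τ φ)) x]

section Map
variable {γ : ℝ} {τ : ℝ → ℝ}

theorem norm_polarMap (γ : ℝ) (τ : ℝ → ℝ) (x : Plane) : ‖polarMap γ τ x‖ = ‖x‖ ^ γ := by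
  have h := Real.sin_sq_add_cos_sq (τ (polarAngle x))
  rw [EuclideanSpace.norm_eq, Real.sqrt_eq_iff_eq_sq (by positivity) (by positivity)]
  simp [polarMap, polarFun, mul_pow]
  linear_combination (‖x‖ ^ γ) ^ 2 * h

theorem polarMap_zero (hγ : 0 < γ) (τ : ℝ → ℝ) : polarMap γ τ 0 = 0 := by
  rw [← norm_eq_zero, norm_polarMap, norm_zero, Real.zero_rpow hγ.ne']

theorem angle_polarMap {x : Plane} (hx : x ≠ 0) (γ : ℝ) (τ : ℝ → ℝ) :
    (polarAngle (polarMap γ τ x) : Real.Angle) = τ (polarAngle x) := by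
  have hn : 0 < ‖x‖ ^ γ := Real.rpow_pos_of_pos (norm_pos_iff.2 hx) _
  have h : planeToComplex (polarMap γ τ x) = (‖x‖ ^ γ : ℝ) *
      (Real.cos (τ (polarAngle x)) + Real.sin (τ (polarAngle x)) * Complex.I) := by
    simp only [planeToComplex_apply, polarMap, polarFun]
    simp
    ring
  rw [polarAngle, h, ← Real.Angle.cos_coe, ← Real.Angle.sin_coe,
    Complex.arg_mul_cos_add_sin_mul_I_coe_angle hn]

/-- The image has polar angle `τ(φ)` only modulo `2π`; since `σ` commutes with this shift, `cos ∘ σ`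
and `sin ∘ σ` do not notice. -/
theorem polarMap_polarMap {σ : ℝ → ℝ} (hγ : 0 < γ) (hσ : ∀ φ, σ (τ φ) = φ)
    (hper : ∀ φ, σ (φ + 2 * Real.pi) = σ φ + 2 * Real.pi) (x : Plane) :
    polarMap γ⁻¹ σ (polarMap γ τ x) = x := by
  by_cases hx : x = 0
  · rw [hx, polarMap_zero hγ, polarMap_zero (inv_pos.2 hγ)]
  have hn : (‖x‖ ^ γ) ^ γ⁻¹ = ‖x‖ := by
    rw [← Real.rpow_mul (norm_nonneg x), mul_inv_cancel₀ hγ.ne', Real.rpow_one]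
  have hc : Function.Periodic (fun φ => Real.cos (σ φ)) (2 * Real.pi) := fun φ => by simp [hper]
  have hs : Function.Periodic (fun φ => Real.sin (σ φ)) (2 * Real.pi) := fun φ => by simp [hper]
  have h1 := hc.eq_of_angle_eq (angle_polarMap hx γ τ)
  have h2 := hs.eq_of_angle_eq (angle_polarMap hx γ τ)
  simp only [hσ] at h1 h2
  ext i
  fin_cases i
  · change ‖polarMap γ τ x‖ ^ γ⁻¹ * Real.cos (σ (polarAngle (polarMap γ τ x))) = x 0
    rw [norm_polarMap, hn, h1, norm_mul_cos_polarAngle]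
  · change ‖polarMap γ τ x‖ ^ γ⁻¹ * Real.sin (σ (polarAngle (polarMap γ τ x))) = x 1
    rw [norm_polarMap, hn, h2, norm_mul_sin_polarAngle]

theorem continuous_polarMap (hγ : 0 < γ) (hτ : Continuous τ)
    (hper : ∀ φ, τ (φ + 2 * Real.pi) = τ φ + 2 * Real.pi) : Continuous (polarMap γ τ) := by
  rw [continuous_iff_continuousAt]
  intro x
  by_cases hx : x = 0
  · subst hx
    rw [ContinuousAt, polarMap_zero hγ, tendsto_zero_iff_norm_tendsto_zero]
    simp only [norm_polarMap]
    have := (continuous_norm (E := Plane)).rpow_const (fun _ => Or.inr hγ.le) (p := γ) |>.tendsto 0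
    simpa [Real.zero_rpow hγ.ne'] using this
  · have hc : Function.Periodic (fun φ => Real.cos (τ φ)) (2 * Real.pi) := fun φ => by simp [hper]
    have hs : Function.Periodic (fun φ => Real.sin (τ φ)) (2 * Real.pi) := fun φ => by simp [hper]
    have h1 := (contDiffAt_polarFun hx γ hc (n := 0) (contDiff_zero.2 (by fun_prop))).continuousAt
    have h2 := (contDiffAt_polarFun hx γ hs (n := 0) (contDiff_zero.2 (by fun_prop))).continuousAt
    refine (PiLp.continuous_toLp 2 _).continuousAt.comp (continuousAt_pi.2 fun i => ?_)
    fin_cases i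
    · exact h1
    · exact h2

/-- The homeomorphism `r e^{iφ} ↦ r ^ γ e^{iτ(φ)}` of the plane. -/
noncomputable def polarHomeomorph (hγ : 0 < γ) (Θ : ℝ ≃ₜ ℝ)
    (hper : ∀ φ, Θ (φ + 2 * Real.pi) = Θ φ + 2 * Real.pi) : Plane ≃ₜ Plane :=
  have hper' : ∀ φ, Θ.symm (φ + 2 * Real.pi) = Θ.symm φ + 2 * Real.pi := fun φ => by
    rw [Θ.symm_apply_eq, hper, Θ.apply_symm_apply]
  { toFun := polarMap γ Θ
    invFun := polarMap γ⁻¹ Θ.symm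
    left_inv := polarMap_polarMap hγ Θ.symm_apply_apply hper'
    right_inv := fun x => by
      have := polarMap_polarMap (inv_pos.2 hγ) Θ.apply_symm_apply hper x
      rwa [inv_inv] at this
    continuous_toFun := continuous_polarMap hγ Θ.continuous hper
    continuous_invFun := continuous_polarMap (inv_pos.2 hγ) Θ.symm.continuous hper' }

end Map

/-- If `ψ = r ^ (-b) sin (Θ(φ))` then `r e^{iφ} ↦ r ^ b e^{iΘ(φ)}` carries the level sets of `ψ` to
those of the dipole stream function. -/
theorem haveHomeomorphicLevelSets_dipoleStream {b : ℝ} (hb : 0 < b) (Θ : ℝ ≃ₜ ℝ)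
    (hper : ∀ φ, Θ (φ + 2 * Real.pi) = Θ φ + 2 * Real.pi) :
    HaveHomeomorphicLevelSets (polarFun (-b) fun φ => Real.sin (Θ φ)) dipoleStream := by
  let h := polarHomeomorph hb Θ hper
  have h0 : h 0 = 0 := polarMap_zero hb Θ
  have key : ∀ x, x ≠ 0 → dipoleStream (h x) = polarFun (-b) (fun φ => Real.sin (Θ φ)) x := by
    intro x hx
    have hn : 0 < ‖x‖ ^ b := Real.rpow_pos_of_pos (norm_pos_iff.2 hx) _
    change ‖x‖ ^ b * Real.sin (Θ (polarAngle x)) / ‖polarMap b Θ x‖ ^ 2 = _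
    rw [norm_polarMap, polarFun, Real.rpow_neg (norm_nonneg x)]
    field_simp
  refine ⟨h, h0, fun k => ?_⟩
  ext y
  constructor
  · rintro ⟨x, ⟨hx, hk⟩, rfl⟩
    exact ⟨fun hy => hx (h.injective (hy.trans h0.symm)), (key x hx).trans hk⟩
  · rintro ⟨hy, hk⟩
    have hx : h.symm y ≠ 0 := fun hx => hy (by rw [← h.apply_symm_apply y, hx, h0])
    refine ⟨h.symm y, ⟨hx, ?_⟩, h.apply_symm_apply y⟩
    rw [← key _ hx, h.apply_symm_apply, hk]

/-! ### Homogeneous velocity fields and the Euler equations -/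

section Field
variable {b κ : ℝ} {w v a : ℝ → ℝ}

/-- The velocity field with stream function `r ^ (-b) w(φ)`, where `v = w'`. -/
noncomputable def polarVelocity (b : ℝ) (w v : ℝ → ℝ) (x : Plane) : Plane :=
  !₂[polarFun (-(b + 1)) (fun φ => Real.cos φ * v φ - b * Real.sin φ * w φ) x,
    polarFun (-(b + 1)) (fun φ => Real.sin φ * v φ + b * Real.cos φ * w φ) x]

theorem polarVelocity_apply_zero (b : ℝ) (w v : ℝ → ℝ) (x : Plane) :
    polarVelocity b w v x 0 =
      polarFun (-(b + 1)) (fun φ => Real.cos φ * v φ - b * Real.sin φ * w φ) x := rfl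

theorem polarVelocity_apply_one (b : ℝ) (w v : ℝ → ℝ) (x : Plane) :
    polarVelocity b w v x 1 =
      polarFun (-(b + 1)) (fun φ => Real.sin φ * v φ + b * Real.cos φ * w φ) x := rfl

theorem isStreamFunction_polarFun (hw : Function.Periodic w (2 * Real.pi))
    (h : ∀ φ, HasDerivAt w (v φ) φ) :
    IsStreamFunction (polarFun (-b) w) (polarVelocity b w v) := by
  intro x hx
  obtain ⟨L, hL, -⟩ := hasFDerivAt_polarFun hx (-b) hw (h _)
  refine ⟨hL.differentiableAt, ?_, ?_⟩
  · rw [partialDeriv_one_polarFun hx (-b) hw (h _)]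
    simp only [polarVelocity, polarFun, PiLp.toLp_apply, Matrix.cons_val_zero]
    rw [show -(b + 1) = -b - 1 by ring]
    ring
  · rw [partialDeriv_zero_polarFun hx (-b) hw (h _)]
    simp only [polarVelocity, polarFun, PiLp.toLp_apply, Matrix.cons_val_one, Matrix.cons_val_zero]
    rw [show -(b + 1) = -b - 1 by ring]
    ring

theorem periodic_velocity_zero (hw : Function.Periodic w (2 * Real.pi))
    (hv : Function.Periodic v (2 * Real.pi)) : Function.Periodic
      (fun φ => Real.cos φ * v φ - b * Real.sin φ * w φ) (2 * Real.pi) := fun φ => by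
  simp [hw φ, hv φ]

theorem periodic_velocity_one (hw : Function.Periodic w (2 * Real.pi))
    (hv : Function.Periodic v (2 * Real.pi)) : Function.Periodic
      (fun φ => Real.sin φ * v φ + b * Real.cos φ * w φ) (2 * Real.pi) := fun φ => by
  simp [hw φ, hv φ]

theorem contDiffOn_polarVelocity {n : WithTop ℕ∞} (hw : Function.Periodic w (2 * Real.pi))
    (hv : Function.Periodic v (2 * Real.pi)) (hwn : ContDiff ℝ n w) (hvn : ContDiff ℝ n v) :
    ContDiffOn ℝ n (polarVelocity b w v) {0}ᶜ := by
  intro x hx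
  refine (contDiffAt_euclidean.2 fun i => ?_).contDiffWithinAt
  have hs : ContDiff ℝ n Real.sin := Real.contDiff_sin
  have hc : ContDiff ℝ n Real.cos := Real.contDiff_cos
  fin_cases i
  · exact contDiffAt_polarFun hx _ (periodic_velocity_zero hw hv) (by fun_prop)
  · exact contDiffAt_polarFun hx _ (periodic_velocity_one hw hv) (by fun_prop)

theorem hasDerivAt_velocity_zero {φ : ℝ} (h : HasDerivAt w (v φ) φ) (h' : HasDerivAt v (a φ) φ) :
    HasDerivAt (fun φ => Real.cos φ * v φ - b * Real.sin φ * w φ)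
      (-((b + 1) * Real.sin φ * v φ) + Real.cos φ * a φ - b * Real.cos φ * w φ) φ := by
  refine (((Real.hasDerivAt_cos φ).mul h').sub
    (((Real.hasDerivAt_sin φ).const_mul b).mul h)).congr_deriv ?_
  ring

theorem hasDerivAt_velocity_one {φ : ℝ} (h : HasDerivAt w (v φ) φ) (h' : HasDerivAt v (a φ) φ) :
    HasDerivAt (fun φ => Real.sin φ * v φ + b * Real.cos φ * w φ)
      ((b + 1) * Real.cos φ * v φ + Real.sin φ * a φ - b * Real.sin φ * w φ) φ := by
  refine (((Real.hasDerivAt_sin φ).mul h').add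
    (((Real.hasDerivAt_cos φ).const_mul b).mul h)).congr_deriv ?_
  ring

/-- The vorticity is `-Δψ`, and `Δ (r ^ (-b) w) = r ^ (-b - 2) (w'' + b² w)`. -/
theorem vorticity_polarVelocity (hw : Function.Periodic w (2 * Real.pi))
    (hv : Function.Periodic v (2 * Real.pi)) (h : ∀ φ, HasDerivAt w (v φ) φ)
    (h' : ∀ φ, HasDerivAt v (a φ) φ) {x : Plane} (hx : x ≠ 0) :
    vorticity (polarVelocity b w v) x = -(‖x‖ ^ (-(b + 1) - 1) *
      (a (polarAngle x) + b ^ 2 * w (polarAngle x))) := by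
  simp only [vorticity, polarVelocity_apply_zero, polarVelocity_apply_one]
  rw [partialDeriv_zero_polarFun hx _ (periodic_velocity_one hw hv)
      (hasDerivAt_velocity_one (h _) (h' _)),
    partialDeriv_one_polarFun hx _ (periodic_velocity_zero hw hv)
      (hasDerivAt_velocity_zero (h _) (h' _))]
  linear_combination (-(‖x‖ ^ (-(b + 1) - 1)) *
    (a (polarAngle x) + b ^ 2 * w (polarAngle x))) * Real.sin_sq_add_cos_sq (polarAngle x)

/-- The polar components `u_r = r ^ (-b - 1) w'` and `u_φ = b r ^ (-b - 1) w` make the angular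
momentum terms cancel. What is left is radial: the defect of the differential equation times `cos φ`
and `sin φ` in the two Cartesian components. -/
theorem isEulerSolution_polarVelocity (hw : Function.Periodic w (2 * Real.pi))
    (hv : Function.Periodic v (2 * Real.pi)) (h : ∀ φ, HasDerivAt w (v φ) φ)
    (h' : ∀ φ, HasDerivAt v (a φ) φ) (hv1 : ContDiff ℝ 1 v) (hw1 : ContDiff ℝ 1 w)
    (hode : ∀ φ, b * w φ * a φ = (b + 1) * v φ ^ 2 + b ^ 2 * w φ ^ 2 - (b + 1) * κ) :
    IsEulerSolution (polarVelocity b w v) (polarFun (-(2 * (b + 1))) fun _ => -(κ / 2)) := by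
  have hp : Function.Periodic (fun _ : ℝ => -(κ / 2)) (2 * Real.pi) := fun _ => rfl
  refine ⟨contDiffOn_polarVelocity hw hv hw1 hv1, fun x hx =>
    (contDiffAt_polarFun hx _ hp contDiff_const).contDiffWithinAt, ?_, ?_⟩
  · intro x hx i
    have hn := norm_pos_iff.2 hx
    have hr : ‖x‖ ^ (-(2 * (b + 1)) - 1) = ‖x‖ ^ (-(b + 1)) * ‖x‖ ^ (-(b + 1) - 1) := by
      rw [← Real.rpow_add hn]
      congr 1
      ring
    have hcs := Real.sin_sq_add_cos_sq (polarAngle x)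
    have ho := hode (polarAngle x)
    rw [Fin.sum_univ_two]
    fin_cases i
    · simp only [Fin.zero_eta, polarVelocity_apply_zero, polarVelocity_apply_one]
      rw [partialDeriv_zero_polarFun hx _ (periodic_velocity_zero hw hv)
          (hasDerivAt_velocity_zero (h _) (h' _)),
        partialDeriv_one_polarFun hx _ (periodic_velocity_zero hw hv)
          (hasDerivAt_velocity_zero (h _) (h' _)),
        partialDeriv_zero_polarFun hx _ hp (hasDerivAt_const _ _), hr, polarFun, polarFun]
      linear_combination (‖x‖ ^ (-(b + 1)) * ‖x‖ ^ (-(b + 1) - 1) *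
          Real.cos (polarAngle x)) * ho +
        (‖x‖ ^ (-(b + 1)) * ‖x‖ ^ (-(b + 1) - 1) * Real.cos (polarAngle x) *
          (b * w (polarAngle x) * a (polarAngle x) - (b + 1) * v (polarAngle x) ^ 2 -
            b ^ 2 * w (polarAngle x) ^ 2)) * hcs
    · simp only [Fin.mk_one, polarVelocity_apply_zero, polarVelocity_apply_one]
      rw [partialDeriv_zero_polarFun hx _ (periodic_velocity_one hw hv)
          (hasDerivAt_velocity_one (h _) (h' _)),
        partialDeriv_one_polarFun hx _ (periodic_velocity_one hw hv)
          (hasDerivAt_velocity_one (h _) (h' _)),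
        partialDeriv_one_polarFun hx _ hp (hasDerivAt_const _ _), hr, polarFun, polarFun]
      linear_combination (‖x‖ ^ (-(b + 1)) * ‖x‖ ^ (-(b + 1) - 1) *
          Real.sin (polarAngle x)) * ho +
        (‖x‖ ^ (-(b + 1)) * ‖x‖ ^ (-(b + 1) - 1) * Real.sin (polarAngle x) *
          (b * w (polarAngle x) * a (polarAngle x) - (b + 1) * v (polarAngle x) ^ 2 -
            b ^ 2 * w (polarAngle x) ^ 2)) * hcs
  · intro x hx
    rw [Fin.sum_univ_two]
    simp only [polarVelocity_apply_zero, polarVelocity_apply_one]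
    rw [partialDeriv_zero_polarFun hx _ (periodic_velocity_zero hw hv)
        (hasDerivAt_velocity_zero (h _) (h' _)),
      partialDeriv_one_polarFun hx _ (periodic_velocity_one hw hv)
        (hasDerivAt_velocity_one (h _) (h' _))]
    ring

end Field

/-! ### Assembly of the solution -/

theorem theorem1p8 (α : ℝ) (hα₁ : 1 < α) (hα₂ : α < 2) :
    ∃ (u : Plane → Plane) (p ψ : Plane → ℝ),
      IsEulerSolution u p ∧
      ContDiffOn ℝ 2 u {0}ᶜ ∧
      IsHomogeneousOfDegree (-α) u ∧
      IsHomogeneousOfDegree (-(2 * α)) p ∧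
      (∃ c : ℝ, ∀ x : Plane, x ≠ 0 → ‖x‖ ^ (2 * α) * p x = c) ∧
      IsReflectionSymmetric u p ∧
      IsRotational u ∧
      IsStreamFunction ψ u ∧
      IsHomogeneousOfDegree (1 - α) ψ ∧
      HaveHomeomorphicLevelSets ψ dipoleStream := by
  obtain ⟨b, rfl⟩ : ∃ b, α = b + 1 := ⟨α - 1, by ring⟩
  have hb : 0 < b := by linarith
  obtain ⟨Θ, v, a, κ, hodd, hadd, hw, hv, ha, hode, hrot⟩ := exists_profile hb (by linarith)
  have hper : ∀ φ, Θ (φ + 2 * Real.pi) = Θ φ + 2 * Real.pi := fun φ => by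
    rw [two_mul, ← add_assoc, hadd, hadd, add_assoc]
  have hwper : Function.Periodic (fun φ => Real.sin (Θ φ)) (2 * Real.pi) := fun φ => by
    simp [hper]
  -- Periodicity and evenness of `v` follow from those of `sin ∘ Θ` (periodic, odd) by uniqueness of
  -- the derivative.
  have hvper : Function.Periodic v (2 * Real.pi) := fun φ => by
    have := (hw (φ + 2 * Real.pi)).comp_add_const φ (2 * Real.pi)
    simp only [hper, Real.sin_add_two_pi] at this
    exact this.unique (hw φ)
  have hveven : ∀ φ, v (-φ) = v φ := fun φ => by
    have := ((hw (-φ)).scomp φ (hasDerivAt_neg φ)).fun_neg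
    simp only [Function.comp_def, hodd, Real.sin_neg, neg_neg] at this
    simpa using this.unique (hw φ)
  have hv2 : ContDiff ℝ 2 v := by
    refine contDiff_succ_iff_deriv (n := 1).2 ⟨fun φ => (hv φ).differentiableAt, by simp, ?_⟩
    rwa [show deriv v = a from funext fun φ => (hv φ).deriv]
  have hw2 : ContDiff ℝ 2 fun φ => Real.sin (Θ φ) := by
    refine contDiff_succ_iff_deriv (n := 1).2 ⟨fun φ => (hw φ).differentiableAt, by simp, ?_⟩
    rw [show deriv (fun φ => Real.sin (Θ φ)) = v from funext fun φ => (hw φ).deriv]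
    exact hv2.of_le one_le_two
  refine ⟨polarVelocity b (fun φ => Real.sin (Θ φ)) v,
    polarFun (-(2 * (b + 1))) fun _ => -(κ / 2), polarFun (-b) fun φ => Real.sin (Θ φ),
    isEulerSolution_polarVelocity hwper hvper hw hv (hv2.of_le one_le_two)
      (hw2.of_le one_le_two) hode,
    contDiffOn_polarVelocity hwper hvper hw2 hv2, ?_, ?_, ⟨-(κ / 2), ?_⟩, ?_, ?_,
    isStreamFunction_polarFun hwper hw, ?_, haveHomeomorphicLevelSets_dipoleStream hb Θ hper⟩
  · intro c hc x _
    ext i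
    fin_cases i
    · simp only [Fin.zero_eta, PiLp.smul_apply, polarVelocity_apply_zero, smul_eq_mul]
      exact polarFun_smul _ _ hc x
    · simp only [Fin.mk_one, PiLp.smul_apply, polarVelocity_apply_one, smul_eq_mul]
      exact polarFun_smul _ _ hc x
  · intro c hc x _
    exact polarFun_smul _ _ hc x
  · intro x hx
    rw [polarFun, ← mul_assoc, ← Real.rpow_add (norm_pos_iff.2 hx), add_neg_cancel,
      Real.rpow_zero, one_mul]
  · intro x hx
    refine ⟨?_, ?_, polarFun_reflectPlane _ (fun _ => rfl) x⟩
    · refine (polarFun_reflectPlane _ (periodic_velocity_zero hwper hvper) x).trans ?_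
      simp [polarVelocity, polarFun, hodd, hveven]
    · refine (polarFun_reflectPlane _ (periodic_velocity_one hwper hvper) x).trans ?_
      simp [polarVelocity, polarFun, hodd, hveven]
      ring
  -- The vorticity is evaluated at `(0, 1)`, where `r = 1` and `φ = π / 2`.
  · have he : planeToComplex (EuclideanSpace.single 1 1) = Complex.I := by
      simp [planeToComplex_apply]
    have hx : (EuclideanSpace.single 1 1 : Plane) ≠ 0 := by simp
    refine ⟨EuclideanSpace.single 1 1, hx, ?_⟩
    rw [vorticity_polarVelocity hwper hvper hw hv hx, polarAngle, he, Complex.arg_I]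
    rw [PiLp.norm_single, norm_one, Real.one_rpow, one_mul]
    exact neg_ne_zero.2 hrot
  · intro c hc x _
    rw [polarFun_smul _ _ hc, smul_eq_mul]
    congr 2
    ring
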